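/- Let $n\ge 0$. All binary trees are planar, with nodes numbered $1,\dots,n$ in in-order. The Tamari order $\preceq$ on binary trees with $n$ nodes is the reflexive and transitive closure of the rotations that replace a subtree $y(x(A,B),C)$ by $x(A,y(B,C))$, and a Tamari interval is a pair $[S,T]$ with $S\preceq T$. The Dyck path of a tree with left subtree $L$ and right subtree $R$ is $D(L)\,1\,D(R)\,0$, where $1$ is an up step and $0$ a down step; the empty tree has the empty path. The complement of $[S,T]$ is $\Psi([S,T])=[T',S']$, where $'$ denotes the mirror image. The grafting tree of $[S,T]$ is the tree $T$ in which the node $i$ carries as label the number of children of $i$ in the decreasing forest of $S$, that is, the number of nodes on the left branch of the right subtree of the node $i$ of $S$. The left-branch involution on labelled binary trees reverses the order of the nodes along every left branch, each node keeping its label and its (transformed) right subtree. For an interval $I=[S,T]$: the contact value is the number of non-initial contacts of the path $D(S)$ with the $x$-axis; the contact vector is $(c_0,\dots,c_{n-1})$, where $c_0$ is the contact value and, for $i\ge 1$, $c_i$ is the number of non-initial contacts of the Dyck path between the $i$-th up step of $D(S)$ and its matching down step; the initial rise is the number of initial up steps of $D(T)$; the rise vector is $(r_0,\dots,r_{n-1})$,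 where $r_{j-1}$ is the number of up steps directly preceding the $j$-th down step of $D(T)$; the distance is the maximal length of a chain of the Tamari order from $S$ to $T$. For $a\ne b$ write $a\lhd b$ if either $a<b$ and $a$ is a descendant of $b$ in $T$, or $a>b$ and $a$ is a descendant of $b$ in $S$. A Tamari inversion of $I$ is a pair $(a,c)$ with $1\le a<c\le n$ such that there is no $b$ with $a\le b<c$ and $c\lhd b$, and no $b$ with $a<b\le c$ and $a\lhd b$. Then for every Tamari interval $I$ there is exactly one Tamari interval $\Phi(I)$ whose grafting tree is the image of the grafting tree of $I$ under the left-branch involution. The rise-contact map $\beta=\Phi\circ\Psi\circ\Phi$ is an involution on the Tamari intervals of size $n$. For every Tamari interval $I$, the contact value of $\beta(I)$ is the initial rise of $I$, and the initial rise of $\beta(I)$ is the contact value of $I$; the multiset of entries of the contact vector of $\beta(I)$ is that of the rise vector of $I$, and the multiset of entries of the rise vector of $\beta(I)$ is that of the contact vector of $I$; the distances of $\beta(I)$ and of $I$ are equal. Moreover, the distance of $I$ is the number of its Tamari inversions. -/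

import Mathlib

namespace Tamari

/-! Binary trees and the Tamari order -/

/-- Tree rotation: `y(x(A, B), C)` becomes `x(A, y(B, C))`, at any node of the tree. -/
inductive Rotation : BinaryTree Unit → BinaryTree Unit → Prop
  | root (A B C : BinaryTree Unit) :
      Rotation (.node () (.node () A B) C) (.node () A (.node () B C))
  | left {L L' : BinaryTree Unit} (R : BinaryTree Unit) :
      Rotation L L' → Rotation (.node () L R) (.node () L' R)
  | right (L : BinaryTree Unit) {R R' : BinaryTree Unit} :
      Rotation R R' → Rotation (.node () L R) (.node () L R')

/-- Reflexive transitive closure of rotation. -/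
def Rot (S T : BinaryTree Unit) : Prop := Relation.ReflTransGen Rotation S T

/-- Sum over all nodes of the size of the right subtree; it grows under rotation. -/
def rightWeight : BinaryTree Unit → ℕ
  | .nil => 0
  | .node _ L R => rightWeight L + rightWeight R + R.numNodes

theorem Rotation.numNodes_eq {S T : BinaryTree Unit} (h : Rotation S T) :
    S.numNodes = T.numNodes := by
  induction h with
  | root A B C => simp only [BinaryTree.numNodes]; omega
  | left R _ ih => simp only [BinaryTree.numNodes, ih]
  | right L _ ih => simp only [BinaryTree.numNodes, ih]

theorem Rotation.rightWeight_lt {S T : BinaryTree Unit} (h : Rotation S T) :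
    rightWeight S < rightWeight T := by
  induction h with
  | root A B C => simp only [rightWeight, BinaryTree.numNodes]; omega
  | left R _ ih => simp only [rightWeight]; omega
  | right L h ih => simp only [rightWeight, h.numNodes_eq]; omega

theorem Rot.eq_or_rightWeight_lt {S T : BinaryTree Unit} (h : Rot S T) :
    S = T ∨ rightWeight S < rightWeight T := by
  induction h with
  | refl => exact Or.inl rfl
  | tail _ h ih =>
    rcases ih with rfl | ih
    · exact Or.inr h.rightWeight_lt
    · exact Or.inr (ih.trans h.rightWeight_lt)

/-- Binary trees with `n` nodes. -/
def TamariTree (n : ℕ) : Type := {T : BinaryTree Unit // T.numNodes = n}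

/-- The Tamari order on binary trees with `n` nodes. -/
instance (n : ℕ) : PartialOrder (TamariTree n) where
  le S T := Rot S.1 T.1
  le_refl _ := Relation.ReflTransGen.refl
  le_trans _ _ _ h h' := Relation.ReflTransGen.trans h h'
  le_antisymm S T h h' := by
    rcases Rot.eq_or_rightWeight_lt h with e | e
    · exact Subtype.ext e
    · rcases Rot.eq_or_rightWeight_lt h' with e' | e'
      · exact Subtype.ext e'.symm
      · omega

/-- Intervals `[lower tree, upper tree]` of the Tamari lattice on `n` nodes. -/
abbrev TamariInterval (n : ℕ) : Type := NonemptyInterval (TamariTree n)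

/-- The lower tree of an interval. -/
def lower {n : ℕ} (I : TamariInterval n) : BinaryTree Unit := I.fst.1

/-- The upper tree of an interval. -/
def upper {n : ℕ} (I : TamariInterval n) : BinaryTree Unit := I.snd.1

theorem Rot.node {L L' R R' : BinaryTree Unit} (hL : Rot L L') (hR : Rot R R') :
    Rot (.node () L R) (.node () L' R') := by
  have h₁ : Rot (.node () L R) (.node () L' R) := by
    induction hL with
    | refl => exact Relation.ReflTransGen.refl
    | tail _ h ih => exact Relation.ReflTransGen.tail ih (.left R h)
  have h₂ : Rot (.node () L' R) (.node () L' R') := by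
    induction hR with
    | refl => exact Relation.ReflTransGen.refl
    | tail _ h ih => exact Relation.ReflTransGen.tail ih (.right L' h)
  exact Relation.ReflTransGen.trans h₁ h₂

/-! The complement involution -/

/-- Mirror image of a binary tree. -/
def mirror : BinaryTree Unit → BinaryTree Unit
  | .nil => .nil
  | .node _ L R => .node () (mirror R) (mirror L)

theorem numNodes_mirror (T : BinaryTree Unit) : (mirror T).numNodes = T.numNodes := by
  induction T with
  | nil => rfl
  | node _ L R ihL ihR => simp only [mirror, BinaryTree.numNodes]; omega

theorem Rotation.mirror {S T : BinaryTree Unit} (h : Rotation S T) :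
    Rotation (Tamari.mirror T) (Tamari.mirror S) := by
  induction h with
  | root A B C => exact .root _ _ _
  | left R _ ih => exact .right _ ih
  | right L _ ih => exact .left _ ih

theorem Rot.mirror {S T : BinaryTree Unit} (h : Rot S T) :
    Rot (Tamari.mirror T) (Tamari.mirror S) := by
  induction h with
  | refl => exact Relation.ReflTransGen.refl
  | tail _ h ih => exact Relation.ReflTransGen.head h.mirror ih

/-- The complement `Ψ [S, T] = [mirror T, mirror S]`. -/
def complement {n : ℕ} (I : TamariInterval n) : TamariInterval n where
  fst := ⟨mirror (upper I), (numNodes_mirror _).trans I.snd.2⟩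
  snd := ⟨mirror (lower I), (numNodes_mirror _).trans I.fst.2⟩
  fst_le_snd := Rot.mirror I.fst_le_snd

/-! Grafting trees -/

/-- The number of nodes on the left branch starting at the root. -/
def leftBranchLength : BinaryTree Unit → ℕ
  | .nil => 0
  | .node _ L _ => leftBranchLength L + 1

/-- The number of children of each node in the decreasing forest of a tree, nodes read in in-order.
In the decreasing forest the right subtree of a node becomes its children and the left subtree its
left siblings, so the children of a node are the left branch of its right subtree. -/
def childCounts : BinaryTree Unit → List ℕ
  | .nil => []
  | .node _ L R => childCounts L ++ leftBranchLength R :: childCounts R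

/-- Put the entries of a list on the nodes of a tree, in in-order. -/
def labelInOrder : BinaryTree Unit → List ℕ → BinaryTree ℕ
  | .nil, _ => .nil
  | .node _ L R, l =>
      .node (l.getD L.numNodes 0) (labelInOrder L (l.take L.numNodes))
        (labelInOrder R (l.drop (L.numNodes + 1)))

/-- The grafting tree of an interval: its shape is the upper tree, and its `i`-th node is labelled
by the number of children of `i` in the decreasing forest of the lower tree. -/
def graftingTree {n : ℕ} (I : TamariInterval n) : BinaryTree ℕ :=
  labelInOrder (upper I) (childCounts (lower I))

/-- Reverse the left branch from the root of the tree, and recursively those of the right subtrees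
hanging on it; the reversed branch is put on top of `acc`. Each node of the branch keeps its
label and its (transformed) right subtree. -/
def leftBranchAux : BinaryTree ℕ → BinaryTree ℕ → BinaryTree ℕ
  | .nil, acc => acc
  | .node l L R, acc => leftBranchAux L (.node l acc (leftBranchAux R .nil))

/-- The left-branch involution on labelled trees: all left branches are reversed. -/
def leftBranch (g : BinaryTree ℕ) : BinaryTree ℕ := leftBranchAux g .nil

/-- The underlying unlabelled tree. -/
def shape (g : BinaryTree ℕ) : BinaryTree Unit := g.map fun _ => ()

/-- Insert a new node between `S` and `T` in in-order, with `S` as left subtree, so that the first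
`r` trees of the decreasing forest of `T` (the `r` lowest nodes of the left branch of `T`) become
the children of the new node in the decreasing forest. -/
def graft (S : BinaryTree Unit) (r : ℕ) : BinaryTree Unit → BinaryTree Unit
  | .nil => .node () S .nil
  | .node _ A B =>
      if r ≤ leftBranchLength A then .node () (graft S r A) B else .node () S (.node () A B)

/-- The lower tree of the interval with a given grafting tree. -/
def lowerOfGrafting : BinaryTree ℕ → BinaryTree Unit
  | .nil => .nil
  | .node r L R => graft (lowerOfGrafting L) r (lowerOfGrafting R)

theorem graft_rot (S : BinaryTree Unit) (r : ℕ) (T : BinaryTree Unit) :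
    Rot (graft S r T) (.node () S T) := by
  induction T with
  | nil => exact Relation.ReflTransGen.refl
  | node u A B ihA _ =>
    cases u
    simp only [graft]
    split_ifs
    · exact Relation.ReflTransGen.tail (Rot.node ihA Relation.ReflTransGen.refl) (.root S A B)
    · exact Relation.ReflTransGen.refl

theorem lowerOfGrafting_rot (g : BinaryTree ℕ) : Rot (lowerOfGrafting g) (shape g) := by
  induction g with
  | nil => exact Relation.ReflTransGen.refl
  | node r L R ihL ihR => exact Relation.ReflTransGen.trans (graft_rot _ r _) (Rot.node ihL ihR)

theorem Rot.numNodes_eq {S T : BinaryTree Unit} (h : Rot S T) : S.numNodes = T.numNodes := by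
  induction h with
  | refl => rfl
  | tail _ h ih => exact ih.trans h.numNodes_eq

theorem numNodes_shape (g : BinaryTree ℕ) : (shape g).numNodes = g.numNodes := by
  induction g with
  | nil => rfl
  | node r L R ihL ihR =>
    simp only [shape] at ihL ihR
    simp only [shape, BinaryTree.map, BinaryTree.numNodes, ihL, ihR]

theorem numNodes_leftBranchAux (g acc : BinaryTree ℕ) :
    (leftBranchAux g acc).numNodes = g.numNodes + acc.numNodes := by
  induction g generalizing acc with
  | nil => simp only [leftBranchAux, BinaryTree.numNodes]; omega
  | node l L R ihL ihR => simp only [leftBranchAux, BinaryTree.numNodes, ihL, ihR]; omega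

theorem numNodes_labelInOrder (T : BinaryTree Unit) (l : List ℕ) :
    (labelInOrder T l).numNodes = T.numNodes := by
  induction T generalizing l with
  | nil => rfl
  | node _ L R ihL ihR => simp only [labelInOrder, BinaryTree.numNodes, ihL, ihR]

/-- The interval with a given grafting tree. -/
def ofGrafting {n : ℕ} (g : BinaryTree ℕ) (hg : g.numNodes = n) : TamariInterval n where
  fst := ⟨lowerOfGrafting g, ((lowerOfGrafting_rot g).numNodes_eq.trans (numNodes_shape g)).trans hg⟩
  snd := ⟨shape g, (numNodes_shape g).trans hg⟩
  fst_le_snd := lowerOfGrafting_rot g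

theorem numNodes_leftBranch_graftingTree {n : ℕ} (I : TamariInterval n) :
    (leftBranch (graftingTree I)).numNodes = n := by
  simp only [leftBranch, numNodes_leftBranchAux, graftingTree, numNodes_labelInOrder,
    BinaryTree.numNodes, add_zero]
  exact I.snd.2

/-- The left-branch involution `Φ` on intervals: reverse the left branches of the grafting tree. -/
def leftBranchInvolution {n : ℕ} (I : TamariInterval n) : TamariInterval n :=
  ofGrafting (leftBranch (graftingTree I)) (numNodes_leftBranch_graftingTree I)

/-- The rise-contact involution `β = Φ ∘ Ψ ∘ Φ`. -/
def riseContact {n : ℕ} : TamariInterval n → TamariInterval n :=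
  leftBranchInvolution ∘ complement ∘ leftBranchInvolution

/-! Dyck paths, contacts and rises -/

/-- The Dyck path of a binary tree: the path of the left subtree, an up step, the path of the right
subtree, a down step. Tree rotation becomes the exchange of a down step with the primitive Dyck path
that follows it. -/
def toDyck : BinaryTree Unit → DyckWord
  | .nil => 0
  | .node _ L R => toDyck L + (toDyck R).nest

/-- For a path read from height `h` above a reference level: the number of down steps ending on that
level before the path first goes below it (or ends). -/
def contactsFrom : ℕ → List DyckStep → ℕ
  | _, [] => 0
  | h, .U :: w => contactsFrom (h + 1) w
  | 0, .D :: _ => 0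
  | 1, .D :: w => contactsFrom 0 w + 1
  | h + 2, .D :: w => contactsFrom (h + 1) w

/-- For each up step, from left to right, the number of non-initial contacts of the Dyck path
between this up step and its matching down step. -/
def upStepContacts : List DyckStep → List ℕ
  | [] => []
  | .U :: w => contactsFrom 0 w :: upStepContacts w
  | .D :: w => upStepContacts w

/-- For each down step, from left to right, the number of up steps directly before it, where `k` up
steps have just been read. -/
def upRuns : ℕ → List DyckStep → List ℕ
  | _, [] => []
  | k, .U :: w => upRuns (k + 1) w
  | k, .D :: w => k :: upRuns 0 w

/-- The contact value of an interval: the number of non-initial contacts of the lower path. -/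
def contactValue {n : ℕ} (I : TamariInterval n) : ℕ :=
  contactsFrom 0 (toDyck (lower I)).toList

/-- The contact vector `c₀, …, c_{n-1}`: `c₀` is the contact value and `c_i` belongs to the `i`-th
up step of the lower path. (The value for the last up step, always `0`, is dropped.) -/
def contactVector {n : ℕ} (I : TamariInterval n) : List ℕ :=
  (contactValue I :: upStepContacts (toDyck (lower I)).toList).dropLast

/-- The initial rise of an interval: the number of initial up steps of the upper path. -/
def initialRise {n : ℕ} (I : TamariInterval n) : ℕ :=
  ((toDyck (upper I)).toList.takeWhile (· = .U)).length

/-- The rise vector: for each down step of the upper path, from left to right, the number of up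
steps directly before it. -/
def riseVector {n : ℕ} (I : TamariInterval n) : List ℕ :=
  upRuns 0 (toDyck (upper I)).toList

/-! Distance and Tamari inversions -/

/-- The distance of an interval: the maximal length of a chain between its two ends. -/
noncomputable def distance {n : ℕ} (I : TamariInterval n) : WithBot ℕ∞ :=
  Order.krullDim (Set.Icc I.fst I.snd)

/-- `Below T a b`: with the nodes of `T` labelled `1, …, n` in in-order, `a` is a proper descendant
of `b`. -/
def Below : BinaryTree Unit → ℕ → ℕ → Prop
  | .nil, _, _ => False
  | .node _ L R, a, b =>
      Below L a b ∨
      (b = L.numNodes + 1 ∧ 1 ≤ a ∧ a ≤ L.numNodes + 1 + R.numNodes ∧ a ≠ b) ∨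
      (L.numNodes + 1 < a ∧ L.numNodes + 1 < b ∧
        Below R (a - (L.numNodes + 1)) (b - (L.numNodes + 1)))

/-- The (strict) interval-poset: the increasing relations of the upper tree together with the
decreasing relations of the lower tree. -/
def Prec {n : ℕ} (I : TamariInterval n) (a b : ℕ) : Prop :=
  (a < b ∧ Below (upper I) a b) ∨ (b < a ∧ Below (lower I) a b)

/-- Tamari inversions: pairs `(a, c)` with `1 ≤ a < c ≤ n` such that no `b` with `a ≤ b < c` has
`c ◁ b` and no `b` with `a < b ≤ c` has `a ◁ b`. -/
def tamariInversions {n : ℕ} (I : TamariInterval n) : Set (ℕ × ℕ) :=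
  {p | 1 ≤ p.1 ∧ p.1 < p.2 ∧ p.2 ≤ n ∧
    (∀ b, p.1 ≤ b → b < p.2 → ¬ Prec I p.2 b) ∧ (∀ b, p.1 < b → b ≤ p.2 → ¬ Prec I p.1 b)}

end Tamari

/-! An interval is equivalent to its grafting tree. The labelled trees that occur are those whose
labels are at most the number of trees in the decreasing forest rebuilt from the right subtree
(`IsGrafting`). Every interval gives one because right subtree sizes grow along the order, and such
a comparison of sizes suffices to build the labelled tree (`exists_isGrafting_of_rightSize_le`). The
rebuilt forest has as many trees as there are nodes minus the sum of the labels, so reversing left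
branches respects the bounds. Hence Φ is a well-defined involution; so is Ψ, and therefore the
conjugate β.

Up to order and a dropped zero, the contact vector consists of the left branch length of the lower
tree and the labels, and Φ preserves both. Ψ turns these data into the lengths of right branches of
the upper tree. After the left branches are reversed, those lengths are the runs of up steps of the
original upper path (`rightBranches_leftBranchAux`). So the contacts of β(I) are the rises of I, and
the other direction follows from involutivity.

For the distance, let the excess be the sum over all nodes of the gap between a label and its bound.
It counts the Tamari inversions (`ncard_inversions`) and is the length of an explicit chain
(`IsGrafting.hasChain`), while inversions are strictly lost whenever the lower tree moves up
(`inversions_ssubset`). So the distance, the number of inversions and the excess agree. Φ preserves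
the excess node by node, and Ψ reverses the order. -/

namespace Tamari

/-! The Tamari order in terms of the sizes of right subtrees -/

/-- The size of the right subtree of the `a`-th node in in-order (`0` if there is none). -/
def rightSize : BinaryTree Unit → ℕ → ℕ
  | .nil, _ => 0
  | .node _ L R, a =>
      if a ≤ L.numNodes then rightSize L a
      else if a = L.numNodes + 1 then R.numNodes
      else rightSize R (a - (L.numNodes + 1))

/-- The total size of the first `r` trees of the decreasing forest. -/
def prefixSize (r : ℕ) : BinaryTree Unit → ℕ
  | .nil => 0
  | .node _ A B =>
      if r ≤ leftBranchLength A then prefixSize r A else A.numNodes + 1 + B.numNodes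

theorem rightSize_zero (S : BinaryTree Unit) : rightSize S 0 = 0 := by
  induction S with
  | nil => rfl
  | node _ L R ihL _ => simp [rightSize, ihL]

theorem rightSize_node_of_le (u : Unit) {L : BinaryTree Unit} (R : BinaryTree Unit) {a : ℕ}
    (h : a ≤ L.numNodes) : rightSize (.node u L R) a = rightSize L a := by
  rw [rightSize, if_pos h]

theorem rightSize_node_root (u : Unit) {L : BinaryTree Unit} (R : BinaryTree Unit) {a : ℕ}
    (h : a = L.numNodes + 1) : rightSize (.node u L R) a = R.numNodes := by
  rw [rightSize, if_neg (by omega), if_pos h]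

theorem rightSize_node_of_gt (u : Unit) {L : BinaryTree Unit} (R : BinaryTree Unit) {a : ℕ}
    (h : L.numNodes + 1 < a) :
    rightSize (.node u L R) a = rightSize R (a - (L.numNodes + 1)) := by
  rw [rightSize, if_neg (by omega), if_neg (by omega)]

theorem rightSize_of_lt (S : BinaryTree Unit) {a : ℕ} (h : S.numNodes < a) :
    rightSize S a = 0 := by
  induction S generalizing a with
  | nil => rfl
  | node _ L R _ ihR =>
    simp only [BinaryTree.numNodes] at h
    rw [rightSize, if_neg (by omega), if_neg (by omega), ihR (by omega)]

theorem add_rightSize_le (S : BinaryTree Unit) {a : ℕ} (h : a ≤ S.numNodes) :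
    a + rightSize S a ≤ S.numNodes := by
  induction S generalizing a with
  | nil => simpa [rightSize] using h
  | node _ L R ihL ihR =>
    simp only [BinaryTree.numNodes] at h ⊢
    rw [rightSize]
    split_ifs with h₁ h₂
    · have := ihL h₁
      omega
    · omega
    · have := ihR (a := a - (L.numNodes + 1)) (by omega)
      omega

/-- Right subtrees are in-order intervals, and a node of a right subtree has its own right subtree
inside it. -/
theorem rightSize_laminar (S : BinaryTree Unit) {a b : ℕ} (hab : a < b)
    (hb : b ≤ a + rightSize S a) : b + rightSize S b ≤ a + rightSize S a := by
  induction S generalizing a b with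
  | nil => simp only [rightSize] at *; omega
  | node _ L R ihL ihR =>
    rw [rightSize] at hb
    rw [rightSize, rightSize]
    rcases lt_trichotomy a (L.numNodes + 1) with h | h | h
    · have ha : a ≤ L.numNodes := by omega
      rw [if_pos ha] at hb ⊢
      have := add_rightSize_le L ha
      rw [if_pos (by omega)]
      exact ihL hab hb
    · have ha : ¬ a ≤ L.numNodes := by omega
      rw [if_neg ha, if_pos h] at hb ⊢
      have := add_rightSize_le R (a := b - (L.numNodes + 1)) (by omega)
      rw [if_neg (by omega), if_neg (by omega)]
      omega
    · have ha : ¬ a ≤ L.numNodes := by omega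
      rw [if_neg ha, if_neg h.ne'] at hb ⊢
      have := ihR (a := a - (L.numNodes + 1)) (b := b - (L.numNodes + 1)) (by omega) (by omega)
      rw [if_neg (by omega), if_neg (by omega)]
      omega

/-- Only the node `x` of the rotation changes its right subtree, from `B` to `y(B, C)`. -/
theorem Rotation.rightSize_le {S T : BinaryTree Unit} (h : Rotation S T) (a : ℕ) :
    rightSize S a ≤ rightSize T a := by
  induction h generalizing a with
  | root A B C =>
    have hAB : (BinaryTree.node () A B).numNodes = A.numNodes + B.numNodes + 1 := rfl
    have hBC : (BinaryTree.node () B C).numNodes = B.numNodes + C.numNodes + 1 := rfl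
    rcases lt_trichotomy a (A.numNodes + 1) with h | h | h
    · rw [rightSize_node_of_le _ _ (by omega), rightSize_node_of_le _ _ (by omega),
        rightSize_node_of_le _ _ (by omega)]
    · rw [rightSize_node_of_le _ _ (by omega), rightSize_node_root _ _ h,
        rightSize_node_root _ _ h]
      omega
    · rw [rightSize_node_of_gt (L := A) _ (.node () B C) h]
      rcases lt_trichotomy a (A.numNodes + B.numNodes + 1 + 1) with h' | h' | h'
      · rw [rightSize_node_of_le _ _ (by omega), rightSize_node_of_gt _ _ h,
          rightSize_node_of_le _ _ (by omega)]
      · rw [rightSize_node_root _ _ (by omega), rightSize_node_root _ _ (by omega)]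
      · rw [rightSize_node_of_gt _ _ (by omega), rightSize_node_of_gt _ _ (by omega), hAB,
          show a - (A.numNodes + 1) - (B.numNodes + 1) = a - (A.numNodes + B.numNodes + 1 + 1)
            by omega]
  | left R h ih =>
    simp only [rightSize, h.numNodes_eq]
    split_ifs
    · exact ih a
    all_goals exact le_rfl
  | right L h ih =>
    simp only [rightSize, h.numNodes_eq]
    split_ifs
    · exact le_rfl
    · exact le_rfl
    · exact ih _

theorem Rot.rightSize_le {S T : BinaryTree Unit} (h : Rot S T) (a : ℕ) :
    rightSize S a ≤ rightSize T a := by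
  induction h with
  | refl => exact le_rfl
  | tail _ h ih => exact ih.trans (h.rightSize_le a)

/-! ### Grafting and right subtree sizes. -/

theorem numNodes_graft (S : BinaryTree Unit) (r : ℕ) (T : BinaryTree Unit) :
    (graft S r T).numNodes = S.numNodes + T.numNodes + 1 :=
  (graft_rot S r T).numNodes_eq

/-- The insertion happens on the left branch of `B`, so the old nodes change at most their left
subtrees. -/
theorem rightSize_graft (A : BinaryTree Unit) (r : ℕ) (B : BinaryTree Unit) (a : ℕ) :
    rightSize (graft A r B) a =
      if a ≤ A.numNodes then rightSize A a
      else if a = A.numNodes + 1 then prefixSize r B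
      else rightSize B (a - (A.numNodes + 1)) := by
  induction B with
  | nil => simp only [graft, rightSize, prefixSize, BinaryTree.numNodes]
  | node _ B C ihB _ =>
    simp only [graft, prefixSize]
    by_cases hr : r ≤ leftBranchLength B
    · simp only [if_pos hr, rightSize, numNodes_graft, ihB]
      split_ifs
      all_goals first
        | omega
        | rfl
        | (congr 1; omega)
    · simp only [if_neg hr, rightSize, BinaryTree.numNodes]
      split_ifs <;> omega

theorem graft_leftBranchLength (A B : BinaryTree Unit) :
    graft A (leftBranchLength B) B = .node () A B := by
  cases B with
  | nil => rfl
  | node _ B C => simp [graft, leftBranchLength]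

/-- A root numbered at most `k` would have a right subtree reaching past `k`. So descending the left
branch meets the node `k + 1`, and the tree is cut there. -/
theorem exists_eq_graft (S : BinaryTree Unit) {k : ℕ} (hk : k < S.numNodes)
    (h : ∀ a ≤ k, a + rightSize S a ≤ k) :
    ∃ A r B, A.numNodes = k ∧ r ≤ leftBranchLength B ∧ S = graft A r B := by
  induction S with
  | nil => simp [BinaryTree.numNodes] at hk
  | node _ A B ihA _ =>
    simp only [BinaryTree.numNodes] at hk
    rcases lt_trichotomy A.numNodes k with hA | hA | hA
    · have := h (A.numNodes + 1) (by omega)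
      simp [rightSize] at this
      omega
    · exact ⟨A, _, B, hA, le_rfl, (graft_leftBranchLength A B).symm⟩
    · obtain ⟨A', r, B', hA', hr, rfl⟩ := ihA hA fun a ha => by
        simpa [rightSize, show a ≤ A.numNodes by omega] using h a ha
      exact ⟨A', r, .node () B' B, hA', by simp only [leftBranchLength]; omega,
        by simp [graft, hr]⟩

/-! Labelled trees that are grafting trees -/

/-- The label of a node is at most the number of trees of the decreasing forest of the lower tree
of its right subtree. -/
def IsGrafting : BinaryTree ℕ → Prop
  | .nil => True
  | .node r L R => IsGrafting L ∧ IsGrafting R ∧ r ≤ leftBranchLength (lowerOfGrafting R)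

/-- The bounds confine the right subtrees of the first `L.numNodes` nodes of `S` to those nodes, so
`S` splits as a graft of two trees to be compared with `L` and `R`. With `lowerOfGrafting_rot`, this
also shows that comparing right sizes detects the Tamari order. -/
theorem exists_isGrafting_of_rightSize_le (T : BinaryTree Unit) {S : BinaryTree Unit}
    (hn : S.numNodes = T.numNodes) (h : ∀ a, rightSize S a ≤ rightSize T a) :
    ∃ g, IsGrafting g ∧ lowerOfGrafting g = S ∧ shape g = T := by
  induction T generalizing S with
  | nil =>
    cases S with
    | nil => exact ⟨.nil, trivial, rfl, rfl⟩
    | node _ A B => simp [BinaryTree.numNodes] at hn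
  | node _ L R ihL ihR =>
    simp only [BinaryTree.numNodes] at hn
    obtain ⟨A, r, B, hA, hr, rfl⟩ := exists_eq_graft S (k := L.numNodes) (by omega) fun a ha => by
      have h₁ := h a
      simp only [rightSize, if_pos ha] at h₁
      have := add_rightSize_le L ha
      omega
    simp only [numNodes_graft] at hn
    obtain ⟨gL, hL, rfl, rfl⟩ := ihL hA fun a => by
      rcases le_or_gt a A.numNodes with ha | ha
      · simpa [rightSize_graft, rightSize, ha, ← hA] using h a
      · simp [rightSize_of_lt A ha]
    obtain ⟨gR, hR, rfl, rfl⟩ := ihR (S := B) (by omega) fun a => by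
      -- The index `0` is no node; shifted, it would hit the root instead of `R`.
      rcases Nat.eq_zero_or_pos a with rfl | ha
      · simp [rightSize_zero]
      · have := h (a + (lowerOfGrafting gL).numNodes + 1)
        rw [rightSize_graft, rightSize, ← hA, if_neg (by omega), if_neg (by omega),
          if_neg (by omega), if_neg (by omega)] at this
        simpa [add_assoc] using this
    exact ⟨.node r gL gR, ⟨hL, hR, hr⟩, rfl, rfl⟩

theorem Rot.exists_isGrafting {S T : BinaryTree Unit} (h : Rot S T) :
    ∃ g, IsGrafting g ∧ lowerOfGrafting g = S ∧ shape g = T :=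
  exists_isGrafting_of_rightSize_le T h.numNodes_eq h.rightSize_le

/-- For larger `r` the new node would only get `leftBranchLength B` children. -/
theorem childCounts_graft (A : BinaryTree Unit) {r : ℕ} {B : BinaryTree Unit}
    (hr : r ≤ leftBranchLength B) :
    childCounts (graft A r B) = childCounts A ++ r :: childCounts B := by
  induction B with
  | nil =>
    obtain rfl : r = 0 := by simpa [leftBranchLength] using hr
    rfl
  | node _ B C ihB _ =>
    rw [graft]
    split_ifs with h
    · simp [childCounts, ihB h]
    · obtain rfl : r = leftBranchLength B + 1 := by
        simp only [leftBranchLength] at hr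
        omega
      simp [childCounts, leftBranchLength]

/-- The forests are joined and the new tree is added, but `r` trees of `B` become its children. -/
theorem leftBranchLength_graft (A : BinaryTree Unit) {r : ℕ} {B : BinaryTree Unit}
    (hr : r ≤ leftBranchLength B) :
    leftBranchLength (graft A r B) + r = leftBranchLength A + leftBranchLength B + 1 := by
  induction B with
  | nil => simp only [leftBranchLength, graft] at *; omega
  | node _ B C ihB _ =>
    rw [graft]
    split_ifs with h
    · have := ihB h
      simp only [leftBranchLength]
      omega
    · simp only [leftBranchLength] at *
      omega

/-- The labels of a tree, in in-order. -/
def labels : BinaryTree ℕ → List ℕ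
  | .nil => []
  | .node r L R => labels L ++ r :: labels R

theorem length_labels (g : BinaryTree ℕ) : (labels g).length = g.numNodes := by
  induction g with
  | nil => rfl
  | node r L R ihL ihR =>
    simp only [labels, List.length_append, List.length_cons, BinaryTree.numNodes, ihL, ihR]
    omega

theorem IsGrafting.childCounts_lowerOfGrafting {g : BinaryTree ℕ} (hg : IsGrafting g) :
    childCounts (lowerOfGrafting g) = labels g := by
  induction g with
  | nil => rfl
  | node r L R ihL ihR =>
    rw [lowerOfGrafting, childCounts_graft _ hg.2.2, ihL hg.1, ihR hg.2.1, labels]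

/-- Every node of the decreasing forest is either a root or a child of exactly one node. Thus the
number of roots depends only on the multiset of labels. -/
theorem IsGrafting.leftBranchLength_lowerOfGrafting {g : BinaryTree ℕ} (hg : IsGrafting g) :
    leftBranchLength (lowerOfGrafting g) + (labels g).sum = g.numNodes := by
  induction g with
  | nil => rfl
  | node r L R ihL ihR =>
    have hL := ihL hg.1
    have hR := ihR hg.2.1
    have h := leftBranchLength_graft (lowerOfGrafting L) hg.2.2
    simp only [lowerOfGrafting, labels, List.sum_append, List.sum_cons, BinaryTree.numNodes]
    omega

theorem labelInOrder_shape_labels (g : BinaryTree ℕ) : labelInOrder (shape g) (labels g) = g := by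
  induction g with
  | nil => rfl
  | node r L R ihL ihR =>
    have h : (labels L).length = (shape L).numNodes := by rw [length_labels, numNodes_shape]
    change labelInOrder (.node () (shape L) (shape R)) (labels L ++ r :: labels R) = _
    rw [labelInOrder, ← h]
    congr 1
    · simp
    · simpa using ihL
    · simpa [List.drop_append, List.drop_eq_nil_of_le] using ihR

/-! ### Intervals are determined by their grafting trees. -/

variable {n : ℕ}

theorem exists_isGrafting (I : TamariInterval n) :
    IsGrafting (graftingTree I) ∧ lowerOfGrafting (graftingTree I) = lower I ∧
      shape (graftingTree I) = upper I := by
  obtain ⟨g, hg, hl, hs⟩ := Rot.exists_isGrafting (S := lower I) (T := upper I) I.fst_le_snd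
  have : graftingTree I = g := by
    rw [graftingTree, ← hl, ← hs, hg.childCounts_lowerOfGrafting, labelInOrder_shape_labels]
  exact this ▸ ⟨hg, hl, hs⟩

theorem graftingTree_injective : Function.Injective (graftingTree (n := n)) := by
  intro I J h
  obtain ⟨-, hI₁, hI₂⟩ := exists_isGrafting I
  obtain ⟨-, hJ₁, hJ₂⟩ := exists_isGrafting J
  refine NonemptyInterval.ext (Prod.ext (Subtype.ext ?_) (Subtype.ext ?_))
  · exact hI₁.symm.trans (h ▸ hJ₁)
  · exact hI₂.symm.trans (h ▸ hJ₂)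

theorem graftingTree_ofGrafting {g : BinaryTree ℕ} (hg : IsGrafting g) (hn : g.numNodes = n) :
    graftingTree (ofGrafting g hn) = g := by
  change labelInOrder (shape g) (childCounts (lowerOfGrafting g)) = g
  rw [hg.childCounts_lowerOfGrafting, labelInOrder_shape_labels]

/-! The left-branch involution on labelled trees -/

theorem labels_leftBranchAux (g acc : BinaryTree ℕ) :
    (labels (leftBranchAux g acc) : Multiset ℕ) = labels g + labels acc := by
  induction g generalizing acc with
  | nil => simp [leftBranchAux, labels]
  | node l L R ihL ihR =>
    rw [leftBranchAux, ihL, labels, labels, ← Multiset.coe_add, ← Multiset.coe_add,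
      ← Multiset.cons_coe, ← Multiset.cons_coe, ihR]
    simp only [labels, Multiset.coe_nil, add_zero, Multiset.add_cons, Multiset.cons_add]
    rw [add_assoc, add_comm (labels acc : Multiset ℕ)]

theorem labels_leftBranch (g : BinaryTree ℕ) :
    (labels (leftBranch g) : Multiset ℕ) = labels g := by
  simp [leftBranch, labels_leftBranchAux, labels]

theorem numNodes_leftBranch (g : BinaryTree ℕ) : (leftBranch g).numNodes = g.numNodes := by
  simp [leftBranch, numNodes_leftBranchAux]

theorem leftBranchLength_lowerOfGrafting_leftBranch {g : BinaryTree ℕ} (hg : IsGrafting g)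
    (hg' : IsGrafting (leftBranch g)) :
    leftBranchLength (lowerOfGrafting (leftBranch g)) = leftBranchLength (lowerOfGrafting g) := by
  have h := hg.leftBranchLength_lowerOfGrafting
  have h' := hg'.leftBranchLength_lowerOfGrafting
  have hs : (labels (leftBranch g)).sum = (labels g).sum := by
    simpa using congrArg Multiset.sum (labels_leftBranch g)
  rw [numNodes_leftBranch] at h'
  omega

/-- The bound at a node depends on its right subtree alone, and transforming that subtree preserves
its number of forest trees. -/
theorem IsGrafting.leftBranchAux {g acc : BinaryTree ℕ} (hg : IsGrafting g)
    (hacc : IsGrafting acc) : IsGrafting (leftBranchAux g acc) := by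
  induction g generalizing acc with
  | nil => exact hacc
  | node l L R ihL ihR =>
    have hR := ihR hg.2.1 (acc := .nil) trivial
    exact ihL hg.1 ⟨hacc, hR,
      hg.2.2.trans_eq (leftBranchLength_lowerOfGrafting_leftBranch hg.2.1 hR).symm⟩

theorem IsGrafting.leftBranch {g : BinaryTree ℕ} (hg : IsGrafting g) :
    IsGrafting (leftBranch g) :=
  hg.leftBranchAux trivial

/-- Put a tree at the left end of the left branch of another tree. -/
def appendLeft : BinaryTree ℕ → BinaryTree ℕ → BinaryTree ℕ
  | .nil, c => c
  | .node l L R, c => .node l (appendLeft L c) R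

theorem appendLeft_nil (g : BinaryTree ℕ) : appendLeft g .nil = g := by
  induction g with
  | nil => rfl
  | node l L R ihL _ => rw [appendLeft, ihL]

/-- The second pass meets the branch of `g` from its deep end and rebuilds `g` over `c` before it
enters `acc`. -/
theorem leftBranchAux_leftBranchAux (g acc c : BinaryTree ℕ) :
    leftBranchAux (leftBranchAux g acc) c = leftBranchAux acc (appendLeft g c) := by
  induction g generalizing acc c with
  | nil => rfl
  | node l L R ihL ihR =>
    rw [leftBranchAux, ihL, leftBranchAux, ihR, leftBranchAux, appendLeft, appendLeft_nil]

theorem leftBranch_leftBranch (g : BinaryTree ℕ) : leftBranch (leftBranch g) = g := by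
  rw [leftBranch, leftBranch, leftBranchAux_leftBranchAux, leftBranchAux, appendLeft_nil]

/-! ### The involutions on intervals. -/

theorem graftingTree_leftBranchInvolution (I : TamariInterval n) :
    graftingTree (leftBranchInvolution I) = leftBranch (graftingTree I) :=
  graftingTree_ofGrafting (exists_isGrafting I).1.leftBranch _

theorem leftBranchInvolution_involutive :
    Function.Involutive (leftBranchInvolution (n := n)) := fun I =>
  graftingTree_injective <| by
    rw [graftingTree_leftBranchInvolution, graftingTree_leftBranchInvolution,
      leftBranch_leftBranch]

theorem mirror_mirror (T : BinaryTree Unit) : mirror (mirror T) = T := by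
  induction T with
  | nil => rfl
  | node _ L R ihL ihR => rw [mirror, mirror, ihL, ihR]

theorem complement_involutive : Function.Involutive (complement (n := n)) := fun _ =>
  NonemptyInterval.ext (Prod.ext (Subtype.ext (mirror_mirror _)) (Subtype.ext (mirror_mirror _)))

theorem riseContact_involutive : Function.Involutive (riseContact (n := n)) := fun I => by
  simp only [riseContact, Function.comp_apply]
  rw [leftBranchInvolution_involutive, complement_involutive, leftBranchInvolution_involutive]


/-! Descendants and right subtree sizes -/

theorem Below.range {T : BinaryTree Unit} {a b : ℕ} (h : Below T a b) :
    1 ≤ a ∧ a ≤ T.numNodes ∧ 1 ≤ b ∧ b ≤ T.numNodes := by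
  induction T generalizing a b with
  | nil => exact h.elim
  | node _ L R ihL ihR =>
    simp only [BinaryTree.numNodes]
    rcases h with h | ⟨rfl, h⟩ | ⟨ha, hb, h⟩
    · have := ihL h
      omega
    · omega
    · have := ihR h
      omega

theorem below_iff_of_lt (S : BinaryTree Unit) {a b : ℕ} (h : b < a) :
    Below S a b ↔ a ≤ b + rightSize S b := by
  induction S generalizing a b with
  | nil => exact iff_of_false id (by rw [rightSize]; omega)
  | node u L R ihL ihR =>
    rw [Below, ihL h]
    rcases lt_trichotomy b (L.numNodes + 1) with hb | hb | hb
    · rw [rightSize_node_of_le _ _ (by omega)]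
      omega
    · rw [rightSize_node_root _ _ hb, rightSize_of_lt L (by omega)]
      omega
    · rw [rightSize_node_of_gt _ _ hb, rightSize_of_lt L (by omega)]
      constructor
      · rintro (h' | h' | ⟨ha, -, h'⟩)
        · omega
        · omega
        · rw [ihR (by omega)] at h'
          omega
      · refine fun h' => Or.inr (Or.inr ⟨by omega, hb, ?_⟩)
        rw [ihR (by omega)]
        omega

/-- If the right subtree of `a` ends before `c`, the next node in in-order is an ancestor of `a`;
otherwise all nodes between `a` and `c`, and `c` itself, are descendants of `a`. -/
theorem forall_not_below_iff (T : BinaryTree Unit) {a c : ℕ} (ha : 1 ≤ a) (hac : a < c)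
    (hc : c ≤ T.numNodes) :
    (∀ b, a < b → b ≤ c → ¬ Below T a b) ↔ c ≤ a + rightSize T a := by
  induction T generalizing a c with
  | nil => simp only [BinaryTree.numNodes] at hc; omega
  | node u L R ihL ihR =>
    simp only [BinaryTree.numNodes] at hc
    rcases lt_trichotomy a (L.numNodes + 1) with h | h | h
    · rw [rightSize_node_of_le _ _ (by omega)]
      have := add_rightSize_le L (a := a) (by omega)
      rcases le_or_gt c L.numNodes with hcL | hcL
      · rw [← ihL ha hac hcL]
        refine forall_congr' fun b => imp_congr_right fun hb => imp_congr_right fun hb' => ?_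
        rw [Below]
        refine not_congr ⟨?_, Or.inl⟩
        rintro (h' | h' | h')
        · exact h'
        · omega
        · omega
      · refine iff_of_false (fun H => ?_) (by omega)
        exact H (L.numNodes + 1) h hcL (Or.inr (Or.inl ⟨rfl, ha, by omega, by omega⟩))
    · rw [rightSize_node_root _ _ h]
      refine iff_of_true (fun b hb _ => ?_) (by omega)
      rintro (h' | h' | h')
      · have := h'.range
        omega
      · omega
      · omega
    · rw [rightSize_node_of_gt _ _ h]
      have key := ihR (a := a - (L.numNodes + 1)) (c := c - (L.numNodes + 1)) (by omega)
        (by omega) (by omega)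
      trans c - (L.numNodes + 1) ≤
        a - (L.numNodes + 1) + rightSize R (a - (L.numNodes + 1))
      · rw [← key]
        constructor
        · intro H b hb hb' hbel
          refine H (b + (L.numNodes + 1)) (by omega) (by omega) (Or.inr (Or.inr ⟨h, by omega, ?_⟩))
          simpa using hbel
        · rintro H b hb hb' (h' | h' | ⟨-, -, h'⟩)
          · have := h'.range
            omega
          · omega
          · exact H _ (by omega) (by omega) h'
      · omega

/-! Counting Tamari inversions -/

/-- Tamari inversions of a pair of trees, in terms of right subtree sizes. -/
def inversions (S T : BinaryTree Unit) : Set (ℕ × ℕ) :=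
  {p | 1 ≤ p.1 ∧ p.1 < p.2 ∧ p.2 ≤ p.1 + rightSize T p.1 ∧
    ∀ b, p.1 ≤ b → b < p.2 → b + rightSize S b < p.2}

theorem le_numNodes_of_le_add_rightSize (T : BinaryTree Unit) {a c : ℕ} (h : a < c)
    (hc : c ≤ a + rightSize T a) : c ≤ T.numNodes := by
  rcases le_or_gt a T.numNodes with ha | ha
  · exact hc.trans (add_rightSize_le T ha)
  · rw [rightSize_of_lt T ha] at hc
    omega

theorem finite_inversions (S T : BinaryTree Unit) : (inversions S T).Finite := by
  refine ((Set.finite_Iic T.numNodes).prod (Set.finite_Iic T.numNodes)).subset ?_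
  rintro ⟨a, c⟩ ⟨-, h, hc, -⟩
  have := le_numNodes_of_le_add_rightSize T h hc
  exact ⟨by simp only [Set.mem_Iic] at *; omega, this⟩

/-- The two conditions separate: relations from `c` down to smaller `b` come from the lower tree,
those from `a` up to larger `b` from the upper tree. -/
theorem tamariInversions_eq {n : ℕ} (I : TamariInterval n) :
    tamariInversions I = inversions (lower I) (upper I) := by
  have hn : (upper I).numNodes = n := I.snd.2
  ext ⟨a, c⟩
  simp only [tamariInversions, inversions, Set.mem_ofPred_eq]
  have key : 1 ≤ a → a < c → c ≤ n →
      ((∀ b, a ≤ b → b < c → ¬ Prec I c b) ∧ (∀ b, a < b → b ≤ c → ¬ Prec I a b) ↔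
        c ≤ a + rightSize (upper I) a ∧
          ∀ b, a ≤ b → b < c → b + rightSize (lower I) b < c) := by
    intro ha hac hc
    rw [← forall_not_below_iff (upper I) ha hac (hc.trans_eq hn.symm), and_comm]
    refine and_congr ?_ ?_ <;>
      refine forall_congr' fun b => imp_congr_right fun hb => imp_congr_right fun hb' => ?_
    · simp only [Prec, hb, true_and, hb.not_gt, false_and, or_false]
    · simp only [Prec, hb', true_and, hb'.not_gt, false_and, false_or, below_iff_of_lt _ hb', not_le]
  constructor
  · rintro ⟨ha, hac, hc, h⟩
    exact ⟨ha, hac, (key ha hac hc).1 h⟩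
  · rintro ⟨ha, hac, h⟩
    have hc : c ≤ n := (le_numNodes_of_le_add_rightSize _ hac h.1).trans_eq hn
    exact ⟨ha, hac, hc, (key ha hac hc).2 h⟩

/-- The last nodes of the trees of the decreasing forest, except for the first `r` trees. -/
def forestRoots (r : ℕ) (B : BinaryTree Unit) : Set ℕ :=
  {c | prefixSize r B < c ∧ c ≤ B.numNodes ∧ ∀ b, 1 ≤ b → b < c → b + rightSize B b < c}

theorem prefixSize_le (r : ℕ) (B : BinaryTree Unit) : prefixSize r B ≤ B.numNodes := by
  induction B with
  | nil => exact le_rfl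
  | node _ B C ihB _ =>
    simp only [prefixSize, BinaryTree.numNodes]
    split_ifs <;> omega

/-- The condition on earlier nodes picks out the left branch: a node of it is preceded only by its
left subtree, and any other node lies in the right subtree of an earlier node of the branch. -/
theorem ncard_forestRoots {r : ℕ} {B : BinaryTree Unit} (hr : r ≤ leftBranchLength B) :
    (forestRoots r B).ncard = leftBranchLength B - r := by
  induction B with
  | nil =>
    convert Set.ncard_empty ℕ
    · ext c
      refine iff_of_false ?_ id
      rintro ⟨h₁, h₂, -⟩
      simp only [BinaryTree.numNodes] at h₂
      omega
    · simp only [leftBranchLength]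
      omega
  | node u B C ihB _ =>
    have hp := prefixSize_le r B
    by_cases h : r ≤ leftBranchLength B
    · have : forestRoots r (.node u B C) = insert (B.numNodes + 1) (forestRoots r B) := by
        ext c
        simp only [forestRoots, prefixSize, if_pos h, BinaryTree.numNodes, Set.mem_insert_iff,
          Set.mem_ofPred_eq]
        constructor
        · rintro ⟨h₁, h₂, h₃⟩
          rcases lt_trichotomy c (B.numNodes + 1) with hc | hc | hc
          · refine Or.inr ⟨h₁, by omega, fun b hb hbc => ?_⟩
            have := h₃ b hb hbc
            rwa [rightSize_node_of_le _ _ (by omega)] at this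
          · exact Or.inl hc
          · have := h₃ _ (by omega) hc
            rw [rightSize_node_root _ _ rfl] at this
            omega
        · rintro (rfl | ⟨h₁, h₂, h₃⟩)
          · refine ⟨by omega, by omega, fun b hb hbc => ?_⟩
            rw [rightSize_node_of_le _ _ (by omega)]
            have := add_rightSize_le B (a := b) (by omega)
            omega
          · refine ⟨h₁, by omega, fun b hb hbc => ?_⟩
            rw [rightSize_node_of_le _ _ (by omega)]
            exact h₃ b hb hbc
      have hfin : (forestRoots r B).Finite :=
        (Set.finite_Iic B.numNodes).subset fun c hc => hc.2.1
      rw [this, Set.ncard_insert_of_notMem (fun hc => by have := hc.2.1; omega) hfin, ihB h,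
        leftBranchLength]
      omega
    · convert Set.ncard_empty ℕ
      · ext c
        refine iff_of_false ?_ id
        rintro ⟨h₁, h₂, -⟩
        simp only [prefixSize, if_neg h, BinaryTree.numNodes] at h₁ h₂
        omega
      · simp only [leftBranchLength] at *
        omega

/-- The three parts correspond to the first entry lying before, at or after the root. Before the
root, the bound from the upper tree keeps `c` inside `L`; at the root, `c` must avoid the `r` trees
already grafted. -/
theorem inversions_graft {A L : BinaryTree Unit} (hA : A.numNodes = L.numNodes) (r : ℕ)
    {B R : BinaryTree Unit} (hB : B.numNodes = R.numNodes) :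
    inversions (graft A r B) (.node () L R) =
      inversions A L ∪ ((fun c => (L.numNodes + 1, c + (L.numNodes + 1))) '' forestRoots r B ∪
        (fun p : ℕ × ℕ => (p.1 + (L.numNodes + 1), p.2 + (L.numNodes + 1))) ''
          inversions B R) := by
  ext ⟨a, c⟩
  simp only [Set.mem_union, Set.mem_image, Prod.exists, Prod.mk.injEq]
  constructor
  · rintro ⟨ha, hac, hc, h⟩
    simp only at ha hac hc h
    rcases lt_trichotomy a (L.numNodes + 1) with hk | hk | hk
    · rw [rightSize_node_of_le _ _ (by omega)] at hc
      have := add_rightSize_le L (a := a) (by omega)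
      refine Or.inl ⟨ha, hac, hc, fun b hb hb' => ?_⟩
      have := h b hb hb'
      rwa [rightSize_graft, if_pos (by simp only at hb'; omega)] at this
    · rw [rightSize_node_root _ _ hk] at hc
      refine Or.inr (Or.inl ⟨c - (L.numNodes + 1), ⟨?_, by omega, fun b hb hb' => ?_⟩, hk.symm,
        by omega⟩)
      · have := h a le_rfl hac
        rw [rightSize_graft, if_neg (by omega), if_pos (by omega)] at this
        omega
      · have := h (b + (L.numNodes + 1)) (by omega) (by omega)
        rw [rightSize_graft, hA, if_neg (by omega), if_neg (by omega), Nat.add_sub_cancel] at this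
        omega
    · rw [rightSize_node_of_gt _ _ hk] at hc
      refine Or.inr (Or.inr ⟨a - (L.numNodes + 1), c - (L.numNodes + 1), ⟨?_, ?_, ?_,
        fun b hb hb' => ?_⟩, by omega, by omega⟩)
      · simp only; omega
      · simp only; omega
      · simp only; omega
      · simp only at hb hb' ⊢
        have := h (b + (L.numNodes + 1)) (by omega) (by omega)
        rw [rightSize_graft, hA, if_neg (by omega), if_neg (by omega), Nat.add_sub_cancel] at this
        omega
  · rintro (⟨ha, hac, hc, h⟩ | ⟨c, ⟨h₁, h₂, h₃⟩, rfl, rfl⟩ | ⟨a, c, ⟨ha, hac, hc, h⟩, rfl, rfl⟩)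
    · simp only at ha hac hc h
      have hcL := le_numNodes_of_le_add_rightSize L hac hc
      refine ⟨ha, hac, ?_, fun b hb hb' => ?_⟩
      · rw [rightSize_node_of_le _ _ (by simp only; omega)]
        exact hc
      · simp only at hb hb' ⊢
        rw [rightSize_graft, if_pos (by omega)]
        exact h b hb hb'
    · refine ⟨?_, ?_, ?_, fun b hb hb' => ?_⟩
      · simp only; omega
      · simp only; omega
      · simp only [rightSize_node_root]; omega
      · simp only at hb hb' ⊢
        rw [rightSize_graft, hA, if_neg (by omega)]
        split_ifs with hbk
        · omega
        · have := h₃ (b - (L.numNodes + 1)) (by omega) (by omega)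
          omega
    · simp only at ha hac hc h
      refine ⟨?_, ?_, ?_, fun b hb hb' => ?_⟩
      · simp only; omega
      · simp only; omega
      · simp only
        rw [rightSize_node_of_gt _ _ (by omega), Nat.add_sub_cancel]
        omega
      · simp only at hb hb' ⊢
        rw [rightSize_graft, hA, if_neg (by omega), if_neg (by omega)]
        have := h (b - (L.numNodes + 1)) (by omega) (by omega)
        omega

/-- The number of Tamari inversions, read off a grafting tree. -/
def excess : BinaryTree ℕ → ℕ
  | .nil => 0
  | .node r L R => leftBranchLength (lowerOfGrafting R) - r + (excess L + excess R)

theorem ncard_inversions {g : BinaryTree ℕ} (hg : IsGrafting g) :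
    (inversions (lowerOfGrafting g) (shape g)).ncard = excess g := by
  induction g with
  | nil =>
    rw [excess]
    convert Set.ncard_empty (ℕ × ℕ)
    ext ⟨a, c⟩
    refine iff_of_false ?_ id
    rintro ⟨-, h₁, h₂, -⟩
    simp only [shape, BinaryTree.map, rightSize] at h₁ h₂
    omega
  | node r L R ihL ihR =>
    have hL : (lowerOfGrafting L).numNodes = (shape L).numNodes :=
      (lowerOfGrafting_rot L).numNodes_eq
    have hR : (lowerOfGrafting R).numNodes = (shape R).numNodes :=
      (lowerOfGrafting_rot R).numNodes_eq
    have hfin : (forestRoots r (lowerOfGrafting R)).Finite :=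
      (Set.finite_Iic (lowerOfGrafting R).numNodes).subset fun c hc => hc.2.1
    change (inversions (graft _ _ _) (.node () (shape L) (shape R))).ncard = _
    have hinj : Function.Injective fun p : ℕ × ℕ =>
        (p.1 + ((shape L).numNodes + 1), p.2 + ((shape L).numNodes + 1)) := by
      rintro ⟨a, c⟩ ⟨b, d⟩ h
      simpa using h
    have hinj' : Function.Injective fun c =>
        ((shape L).numNodes + 1, c + ((shape L).numNodes + 1)) := by
      intro c d h
      simpa using h
    have hfin' := (finite_inversions (lowerOfGrafting R) (shape R)).image fun p =>
      (p.1 + ((shape L).numNodes + 1), p.2 + ((shape L).numNodes + 1))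
    rw [inversions_graft hL r hR,
      Set.ncard_union_eq ?_ (finite_inversions _ _) ((hfin.image _).union hfin'),
      Set.ncard_union_eq ?_ (hfin.image _) hfin', Set.ncard_image_of_injective _ hinj,
      Set.ncard_image_of_injective _ hinj', ihL hg.1, ihR hg.2.1, ncard_forestRoots hg.2.2, excess]
    · omega
    · rw [Set.disjoint_left]
      rintro _ ⟨c, -, rfl⟩ ⟨⟨a, d⟩, ⟨ha, -⟩, h⟩
      simp only [Prod.mk.injEq] at h ha
      omega
    · rw [Set.disjoint_left]
      rintro ⟨a, c⟩ ⟨ha, hac, hc, -⟩ (⟨d, -, h⟩ | ⟨⟨b, d⟩, -, h⟩) <;>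
      · have := le_numNodes_of_le_add_rightSize _ hac hc
        simp only [Prod.mk.injEq] at h this hac
        omega

/-- Each node keeps both its label and its bound. -/
theorem excess_leftBranchAux {g acc : BinaryTree ℕ} (hg : IsGrafting g) :
    excess (leftBranchAux g acc) = excess g + excess acc := by
  induction g generalizing acc with
  | nil => simp [leftBranchAux, excess]
  | node l L R ihL ihR =>
    have h := leftBranchLength_lowerOfGrafting_leftBranch hg.2.1 hg.2.1.leftBranch
    have h' := ihR hg.2.1 (acc := .nil)
    rw [leftBranch] at h
    rw [leftBranchAux, ihL hg.1, excess, excess, h, h', excess]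
    omega

/-! Chains of the Tamari order -/

/-- There is a chain of a given length between two trees. -/
inductive HasChain : ℕ → BinaryTree Unit → BinaryTree Unit → Prop
  | refl (S : BinaryTree Unit) : HasChain 0 S S
  | tail {k : ℕ} {S T U : BinaryTree Unit} :
      HasChain k S T → Rot T U → T ≠ U → HasChain (k + 1) S U

theorem HasChain.trans {k l : ℕ} {S T U : BinaryTree Unit} (h : HasChain k S T)
    (h' : HasChain l T U) : HasChain (k + l) S U := by
  induction h' with
  | refl => exact h
  | tail _ hr hne ih => exact (ih h).tail hr hne

theorem HasChain.left {k : ℕ} {L L' : BinaryTree Unit} (h : HasChain k L L')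
    (R : BinaryTree Unit) : HasChain k (.node () L R) (.node () L' R) := by
  induction h with
  | refl => exact .refl _
  | tail _ hr hne ih =>
    exact ih.tail (hr.node .refl) fun h => hne (BinaryTree.node.inj h).2.1

theorem HasChain.right {k : ℕ} {R R' : BinaryTree Unit} (L : BinaryTree Unit)
    (h : HasChain k R R') : HasChain k (.node () L R) (.node () L R') := by
  induction h with
  | refl => exact .refl _
  | tail _ hr hne ih =>
    exact ih.tail (Rot.node .refl hr) fun h => hne (BinaryTree.node.inj h).2.2

/-- Each rotation lifts the new node one step up the left branch and gives it one more forest tree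
as a child. -/
theorem hasChain_graft (A : BinaryTree Unit) {r : ℕ} {B : BinaryTree Unit}
    (hr : r ≤ leftBranchLength B) :
    HasChain (leftBranchLength B - r) (graft A r B) (.node () A B) := by
  induction B with
  | nil =>
    rw [leftBranchLength, Nat.zero_sub]
    exact .refl _
  | node u B C ihB _ =>
    rw [graft, leftBranchLength]
    split_ifs with h
    · rw [Nat.sub_add_comm h]
      have hrot : Rotation (.node () (.node () A B) C) (.node () A (.node () B C)) := .root A B C
      refine ((ihB h).left C).tail (.single hrot) fun he => ?_
      exact absurd (he ▸ hrot.rightWeight_lt) (lt_irrefl _)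
    · rw [leftBranchLength] at hr
      rw [show leftBranchLength B + 1 - r = 0 by omega]
      exact .refl _

theorem IsGrafting.hasChain {g : BinaryTree ℕ} (hg : IsGrafting g) :
    HasChain (excess g) (lowerOfGrafting g) (shape g) := by
  induction g with
  | nil => exact .refl _
  | node r L R ihL ihR =>
    exact (hasChain_graft _ hg.2.2).trans (((ihL hg.1).left _).trans ((ihR hg.2.1).right _))

theorem HasChain.exists_ltSeries {n k : ℕ} {S T : BinaryTree Unit} (h : HasChain k S T)
    (x y : TamariTree n) (hx : x.1 = S) (hy : y.1 = T) :
    ∃ p : LTSeries (TamariTree n), p.length = k ∧ p.head = x ∧ p.last = y := by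
  induction h generalizing y with
  | refl S =>
    obtain rfl : x = y := Subtype.ext (hx.trans hy.symm)
    exact ⟨RelSeries.singleton _ x, rfl, rfl, rfl⟩
  | @tail k S T U _ hr hne ih =>
    let z : TamariTree n := ⟨T, hr.numNodes_eq.trans (hy ▸ y.2)⟩
    obtain ⟨p, hk, hp, hl⟩ := ih z hx rfl
    have hzy : z ≤ y := by
      change Rot T y.1
      exact hy ▸ hr
    have hlt : z < y := lt_of_le_of_ne hzy fun e => hne ((congrArg Subtype.val e).trans hy)
    refine ⟨p.snoc y (hl ▸ hlt), ?_, ?_, ?_⟩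
    · simp [hk]
    · simpa using hp
    · simp

/-- Larger right subtrees in the lower tree make the condition on `b` harder. If no inversion were
lost, no right subtree would have grown, and the two trees would coincide. -/
theorem inversions_ssubset {S S' T : BinaryTree Unit} (h : Rot S S') (hne : S ≠ S')
    (h' : Rot S' T) : inversions S' T ⊂ inversions S T := by
  refine ⟨fun p ⟨h₁, h₂, h₃, h₄⟩ => ⟨h₁, h₂, h₃, fun b hb hb' => ?_⟩, fun hsub => ?_⟩
  · have := h₄ b hb hb'
    have := h.rightSize_le b
    omega
  · have key : ∀ a, rightSize S' a ≤ rightSize S a := by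
      intro a
      by_contra! ha
      have ha₀ : a ≠ 0 := by
        rintro rfl
        simp [rightSize_zero] at ha
      -- The first node after the right subtree of `a` in `S`: by laminarity no subtree in between
      -- reaches it, but in `S'` that of `a` does.
      have hmem : (a, a + rightSize S a + 1) ∈ inversions S T := by
        refine ⟨by simp only; omega, by simp only; omega, ?_, fun b hb hb' => ?_⟩
        · have := h'.rightSize_le a
          simp only
          omega
        · simp only at hb hb' ⊢
          rcases hb.eq_or_lt with rfl | hb
          · omega
          · have := rightSize_laminar S hb (by omega)
            omega
      have := (hsub hmem).2.2.2 a le_rfl (by simp only; omega)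
      simp only at this
      omega
    -- This makes `S'` lie below `S`, against antisymmetry.
    obtain ⟨g, -, rfl, rfl⟩ := exists_isGrafting_of_rightSize_le S h.numNodes_eq.symm key
    rcases (lowerOfGrafting_rot g).eq_or_rightWeight_lt with e | e
    · exact hne e.symm
    · rcases h.eq_or_rightWeight_lt with e' | e'
      · exact hne e'
      · omega

/-! ### The distance of an interval. -/

theorem ncard_tamariInversions (I : TamariInterval n) :
    (tamariInversions I).ncard = excess (graftingTree I) := by
  obtain ⟨hg, hl, hs⟩ := exists_isGrafting I
  rw [tamariInversions_eq, ← hl, ← hs, ncard_inversions hg]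

theorem distance_eq_ncard (I : TamariInterval n) :
    distance I = ((tamariInversions I).ncard : WithBot ℕ∞) := by
  apply le_antisymm
  · rw [tamariInversions_eq]
    let f : Set.Icc I.fst I.snd → ℕ := fun x => (inversions x.1.1 (upper I)).ncard
    have hf : StrictAnti f := fun x y hxy =>
      Set.ncard_lt_ncard (inversions_ssubset hxy.le
        (fun e => hxy.ne (Subtype.ext (Subtype.ext e))) y.2.2) (finite_inversions _ _)
    have hle : ∀ x, f x ≤ f ⟨I.fst, le_rfl, I.fst_le_snd⟩ := fun x => hf.antitone x.2.1
    refine iSup_le fun p => ?_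
    -- Counting lost inversions turns the chain into a strictly increasing one in ℕ, bounded by the
    -- inversions of the whole interval.
    let q : LTSeries ℕ := p.map (fun x => f ⟨I.fst, le_rfl, I.fst_le_snd⟩ - f x)
      fun x y hxy => by
        have h₁ := hf hxy
        have h₂ := hle x
        change _ - f x < _ - f y
        omega
    have hq : q.head + q.length ≤ q.last := q.head_add_length_le_nat
    have hlast : q.last ≤ f ⟨I.fst, le_rfl, I.fst_le_snd⟩ := Nat.sub_le _ _
    have : p.length ≤ f ⟨I.fst, le_rfl, I.fst_le_snd⟩ := by
      have : q.length = p.length := rfl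
      omega
    exact_mod_cast this
  · rw [ncard_tamariInversions]
    obtain ⟨hg, hl, hs⟩ := exists_isGrafting I
    obtain ⟨p, hk, hp, hp'⟩ := hg.hasChain.exists_ltSeries I.fst I.snd hl.symm hs.symm
    let q : LTSeries (Set.Icc I.fst I.snd) :=
      { length := p.length
        toFun := fun i => ⟨p i, hp ▸ LTSeries.head_le p i, hp' ▸ p.monotone (Fin.le_last i)⟩
        step := p.step }
    have := Order.LTSeries.length_le_krullDim q
    rw [← hk]
    exact this

theorem distance_leftBranchInvolution (I : TamariInterval n) :
    distance (leftBranchInvolution I) = distance I := by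
  rw [distance_eq_ncard, distance_eq_ncard, ncard_tamariInversions, ncard_tamariInversions,
    graftingTree_leftBranchInvolution, leftBranch, excess_leftBranchAux (exists_isGrafting I).1,
    excess, add_zero]

theorem distance_complement_le (I : TamariInterval n) :
    distance (complement I) ≤ distance I := by
  rw [distance, distance, ← Order.krullDim_orderDual (α := Set.Icc I.fst I.snd)]
  have mir {x y : TamariTree n} (h : x ≤ y) : Rot (mirror y.1) (mirror x.1) := Rot.mirror h
  refine Order.krullDim_le_of_strictMono
    (fun x => OrderDual.toDual ⟨⟨mirror x.1.1, (numNodes_mirror _).trans x.1.2⟩, ?_, ?_⟩)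
    fun x y hxy => ?_
  · have := mir x.2.2
    rw [show (complement I).snd.1 = mirror (lower I) from rfl, mirror_mirror] at this
    exact this
  · have := mir x.2.1
    rw [show (complement I).fst.1 = mirror (upper I) from rfl, mirror_mirror] at this
    exact this
  · refine OrderDual.toDual_lt_toDual.2 (lt_of_le_of_ne (mir hxy.le) fun e => hxy.ne ?_)
    have := congrArg (fun z => mirror z.1.1) e
    simp only [mirror_mirror] at this
    exact (Subtype.ext (Subtype.ext this)).symm

theorem distance_complement (I : TamariInterval n) : distance (complement I) = distance I := by
  refine (distance_complement_le I).antisymm ?_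
  simpa only [complement_involutive I] using distance_complement_le (complement I)

theorem distance_riseContact (I : TamariInterval n) :
    distance (riseContact I) = distance I := by
  simp only [riseContact, Function.comp_apply, distance_leftBranchInvolution, distance_complement]

open DyckStep

/-! Dyck paths of trees -/

theorem toList_toDyck_node (u : Unit) (L R : BinaryTree Unit) :
    (toDyck (.node u L R)).toList = (toDyck L).toList ++ U :: ((toDyck R).toList ++ [D]) := by
  change _ ++ ([U] ++ _ ++ [D]) = _
  simp

/-! Contacts of the lower path -/

/-- Both heights are needed together: each node of the left branch closes one arch on the reference
level, and whatever lies inside an arch is read from a positive height and makes no contact. -/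
theorem contactsFrom_toDyck_append (T : BinaryTree Unit) (w : List DyckStep) :
    contactsFrom 0 ((toDyck T).toList ++ w) = leftBranchLength T + contactsFrom 0 w ∧
      ∀ h, contactsFrom (h + 1) ((toDyck T).toList ++ w) = contactsFrom (h + 1) w := by
  induction T generalizing w with
  | nil =>
    change contactsFrom 0 ([] ++ w) = _ ∧ ∀ h, contactsFrom (h + 1) ([] ++ w) = _
    simp [leftBranchLength]
  | node u L R ihL ihR =>
    simp only [toList_toDyck_node, List.append_assoc, List.cons_append, List.nil_append]
    refine ⟨?_, fun h => ?_⟩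
    · rw [(ihL _).1, contactsFrom, (ihR _).2, contactsFrom, leftBranchLength]
      omega
    · rw [(ihL _).2, contactsFrom, (ihR _).2, contactsFrom]

theorem upStepContacts_toDyck_append (T : BinaryTree Unit) (w : List DyckStep) :
    upStepContacts ((toDyck T).toList ++ w) = childCounts T ++ upStepContacts w := by
  induction T generalizing w with
  | nil => rfl
  | node u L R ihL ihR =>
    simp only [toList_toDyck_node, List.append_assoc, List.cons_append, List.nil_append]
    rw [ihL, upStepContacts, ihR, (contactsFrom_toDyck_append R _).1, contactsFrom, upStepContacts,
      childCounts]
    simp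

theorem getLast_childCounts (S : BinaryTree Unit) (h : childCounts S ≠ []) :
    (childCounts S).getLast h = 0 := by
  induction S with
  | nil => exact absurd rfl h
  | node _ L R _ ihR =>
    cases R with
    | nil => simp [childCounts, leftBranchLength]
    | node _ A B =>
      have hR : childCounts (.node () A B) ≠ [] := by simp [childCounts]
      simp only [childCounts] at ihR hR ⊢
      rw [List.getLast_append_of_ne_nil _ (by simp), List.getLast_cons hR]
      exact ihR hR

/-- The last node has no right subtree. For the empty tree, the dropped zero is the contact value
itself. -/
theorem dropLast_cons_childCounts (S : BinaryTree Unit) :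
    (leftBranchLength S :: childCounts S).dropLast ++ [0] =
      leftBranchLength S :: childCounts S := by
  by_cases h : childCounts S = []
  · cases S with
    | nil => rfl
    | node _ L R => simp [childCounts] at h
  · conv_rhs => rw [← List.dropLast_append_getLast (List.cons_ne_nil _ (childCounts S))]
    rw [List.getLast_cons h, getLast_childCounts]

theorem contactValue_eq (I : TamariInterval n) : contactValue I = leftBranchLength (lower I) := by
  rw [contactValue, ← List.append_nil (toDyck _).toList, (contactsFrom_toDyck_append _ _).1,
    contactsFrom, add_zero]

theorem contactVector_add_zero (I : TamariInterval n) :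
    (contactVector I : Multiset ℕ) + {0} =
      leftBranchLength (lower I) ::ₘ (childCounts (lower I) : Multiset ℕ) := by
  have h : upStepContacts (toDyck (lower I)).toList = childCounts (lower I) := by
    simpa [upStepContacts] using upStepContacts_toDyck_append (lower I) []
  rw [contactVector, contactValue_eq, h, Multiset.cons_coe]
  conv_rhs => rw [← dropLast_cons_childCounts]
  rfl

theorem contactValue_leftBranchInvolution (I : TamariInterval n) :
    contactValue (leftBranchInvolution I) = contactValue I := by
  obtain ⟨hg, hl, -⟩ := exists_isGrafting I
  obtain ⟨hg', hl', -⟩ := exists_isGrafting (leftBranchInvolution I)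
  rw [graftingTree_leftBranchInvolution] at hg' hl'
  rw [contactValue_eq, contactValue_eq, ← hl, ← hl',
    leftBranchLength_lowerOfGrafting_leftBranch hg hg']

theorem contactVector_leftBranchInvolution (I : TamariInterval n) :
    (contactVector (leftBranchInvolution I) : Multiset ℕ) = contactVector I := by
  have hv := contactValue_leftBranchInvolution I
  rw [contactValue_eq, contactValue_eq] at hv
  obtain ⟨hg, hl, -⟩ := exists_isGrafting I
  obtain ⟨hg', hl', -⟩ := exists_isGrafting (leftBranchInvolution I)
  rw [graftingTree_leftBranchInvolution] at hg' hl'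
  apply add_right_cancel (b := {0})
  rw [contactVector_add_zero, contactVector_add_zero, hv, ← hl', ← hl,
    hg.childCounts_lowerOfGrafting, hg'.childCounts_lowerOfGrafting, labels_leftBranch]

/-! Rises of the upper path -/

/-- The number of nodes on the right branch starting at the root. -/
def rightBranchLength : BinaryTree Unit → ℕ
  | .nil => 0
  | .node _ _ R => rightBranchLength R + 1

/-- The lengths of the right branches starting at the root and at the left children (those of
missing left children being `0`), where `k` is added to the first one. -/
def rightBranches : ℕ → BinaryTree Unit → Multiset ℕ
  | k, .nil => {k}
  | k, .node _ L R => rightBranches 0 L + rightBranches (k + 1) R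

theorem leftBranchLength_mirror (T : BinaryTree Unit) :
    leftBranchLength (mirror T) = rightBranchLength T := by
  induction T with
  | nil => rfl
  | node _ L R _ ihR => rw [mirror, leftBranchLength, rightBranchLength, ihR]

/-- A right branch starting at a left child mirrors to a left branch starting at a right child,
whose length is a child count. -/
theorem rightBranches_eq (k : ℕ) (T : BinaryTree Unit) :
    rightBranches k T =
      (k + rightBranchLength T) ::ₘ (childCounts (mirror T) : Multiset ℕ) := by
  induction T generalizing k with
  | nil => rfl
  | node _ L R ihL ihR =>
    rw [rightBranches, ihL, ihR, mirror, childCounts, ← Multiset.coe_add, ← Multiset.cons_coe,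
      leftBranchLength_mirror, rightBranchLength, zero_add, Multiset.add_cons, Multiset.cons_add,
      Multiset.add_cons, add_assoc, add_comm 1, add_comm (childCounts (mirror L) : Multiset ℕ)]

theorem contactVector_complement_add_zero (I : TamariInterval n) :
    (contactVector (complement I) : Multiset ℕ) + {0} = rightBranches 0 (upper I) := by
  rw [contactVector_add_zero, rightBranches_eq, zero_add, ← leftBranchLength_mirror]
  rfl

/-- A nonempty Dyck path ends with a down step, which resets the counter; for the empty path the
pending `k` would pass on to `w`. -/
theorem upRuns_toDyck_append {T : BinaryTree Unit} (hT : T ≠ .nil) (k : ℕ) (w : List DyckStep) :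
    upRuns k ((toDyck T).toList ++ w) = upRuns k (toDyck T).toList ++ upRuns 0 w := by
  have key : ∀ (v : List DyckStep) (k : ℕ),
      upRuns k (v ++ D :: w) = upRuns k (v ++ [D]) ++ upRuns 0 w := by
    intro v
    induction v with
    | nil => intro k; rfl
    | cons s v ih =>
      intro k
      cases s with
      | U => exact ih (k + 1)
      | D => exact congrArg (List.cons k) (ih 0)
  cases T with
  | nil => exact absurd rfl hT
  | node u L R =>
    rw [toList_toDyck_node, ← List.cons_append, ← List.append_assoc, List.append_assoc _ [D]]
    exact key _ k

/-- The lengths of the runs of up steps of the Dyck path, a final one of length `0` included,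
where `k` is added to the first one. -/
def rises (k : ℕ) (T : BinaryTree Unit) : Multiset ℕ :=
  (upRuns k ((toDyck T).toList ++ [D]) : List ℕ)

theorem rises_eq_add_zero {T : BinaryTree Unit} (hT : T ≠ .nil) (k : ℕ) :
    rises k T = (upRuns k (toDyck T).toList : Multiset ℕ) + {0} := by
  rw [rises, upRuns_toDyck_append hT]
  rfl

theorem upRuns_toDyck_append_down_down (k : ℕ) (R : BinaryTree Unit) :
    (upRuns k ((toDyck R).toList ++ [D, D]) : Multiset ℕ) = rises k R + {0} := by
  cases R with
  | nil => rfl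
  | node u A B =>
    rw [rises_eq_add_zero (by simp), upRuns_toDyck_append (by simp)]
    change ((_ ++ ([0] ++ [0]) : List ℕ) : Multiset ℕ) = _
    rw [← Multiset.coe_add, ← Multiset.coe_add, add_assoc]
    rfl

theorem rises_node_nil (k : ℕ) (u : Unit) (R : BinaryTree Unit) :
    rises k (.node u .nil R) = rises (k + 1) R + {0} := by
  rw [← upRuns_toDyck_append_down_down, rises, toList_toDyck_node]
  change (upRuns k (U :: _) : Multiset ℕ) = _
  simp [upRuns]

theorem rises_node (k : ℕ) (u : Unit) {L : BinaryTree Unit} (hL : L ≠ .nil)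
    (R : BinaryTree Unit) : rises k (.node u L R) = rises k L + rises 1 R := by
  rw [rises, toList_toDyck_node, List.append_assoc, upRuns_toDyck_append hL, ← Multiset.coe_add,
    rises_eq_add_zero hL, add_assoc, add_comm {0}, ← upRuns_toDyck_append_down_down]
  simp [upRuns]

theorem shape_node (r : ℕ) (L R : BinaryTree ℕ) :
    shape (.node r L R) = .node () (shape L) (shape R) := rfl

/-- The deepest node of the left branch opens the Dyck path and becomes the root, so the first run
is the right branch there. Every other node of the branch has its up step after a down step and
becomes a left child, so each starts both a new run and a new right branch. -/
theorem rightBranches_leftBranchAux (k : ℕ) (g acc : BinaryTree ℕ) (hg : g ≠ .nil) :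
    rightBranches k (shape (leftBranchAux g acc)) + {0} =
      rises k (shape g) + rightBranches 0 (shape acc) := by
  induction g generalizing k acc with
  | nil => exact absurd rfl hg
  | node l L R ihL ihR =>
    -- An empty accumulator contributes exactly the zero on the other side.
    have hR : ∀ k, rightBranches k (shape (leftBranchAux R .nil)) = rises k (shape R) := by
      intro k
      by_cases h : R = .nil
      · subst h
        rfl
      · exact add_right_cancel (ihR k .nil h)
    rw [leftBranchAux, shape_node]
    by_cases h : L = .nil
    · subst h
      rw [leftBranchAux, shape_node, rightBranches, hR]
      change _ = rises k (.node () .nil (shape R)) + _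
      rw [rises_node_nil, add_comm (rightBranches 0 _), add_right_comm]
    · have hL : shape L ≠ .nil := by
        cases L with
        | nil => exact absurd rfl h
        | node => simp [shape_node]
      rw [ihL _ _ h, shape_node, rightBranches, hR, rises_node k () hL, add_assoc,
        add_comm (rightBranches 0 _), zero_add]

theorem rightBranches_leftBranch (g : BinaryTree ℕ) :
    rightBranches 0 (shape (leftBranch g)) =
      (upRuns 0 (toDyck (shape g)).toList : Multiset ℕ) + {0} := by
  cases g with
  | nil => rfl
  | node l L R =>
    rw [← rises_eq_add_zero (by simp [shape_node])]
    exact add_right_cancel (rightBranches_leftBranchAux 0 _ .nil (by simp))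

theorem upper_leftBranchInvolution (I : TamariInterval n) :
    upper (leftBranchInvolution I) = shape (leftBranch (graftingTree I)) := rfl

theorem contactVector_riseContact (I : TamariInterval n) :
    (contactVector (riseContact I) : Multiset ℕ) = riseVector I := by
  simp only [riseContact, Function.comp_apply]
  apply add_right_cancel (b := {0})
  rw [contactVector_leftBranchInvolution, contactVector_complement_add_zero,
    upper_leftBranchInvolution, rightBranches_leftBranch, (exists_isGrafting I).2.2]
  rfl

/-! ### The initial rise and the contact value. -/

/-- The number of initial up steps of the Dyck path of a tree. -/
def initialUps (T : BinaryTree Unit) : ℕ :=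
  ((toDyck T).toList.takeWhile (· = .U)).length

theorem takeWhile_toDyck_append {T : BinaryTree Unit} (hT : T ≠ .nil) (w : List DyckStep) :
    (((toDyck T).toList ++ w).takeWhile (· = .U)).length = initialUps T := by
  have key : ∀ v : List DyckStep, (v ++ D :: w).takeWhile (· = .U) =
      (v ++ [D]).takeWhile (· = .U) := by
    intro v
    induction v with
    | nil => rfl
    | cons s v ih =>
      cases s with
      | U => exact congrArg (List.cons U) ih
      | D => rfl
  cases T with
  | nil => exact absurd rfl hT
  | node u L R =>
    rw [initialUps, toList_toDyck_node, ← List.cons_append, ← List.append_assoc,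
      List.append_assoc _ [D]]
    exact congrArg List.length (key _)

theorem initialUps_node_nil (u : Unit) (R : BinaryTree Unit) :
    initialUps (.node u .nil R) = initialUps R + 1 := by
  rw [initialUps, toList_toDyck_node]
  change (((toDyck R).toList ++ [D]).takeWhile (· = .U)).length + 1 = _
  cases R with
  | nil => rfl
  | node => rw [takeWhile_toDyck_append (by simp)]

theorem initialUps_node (u : Unit) {L : BinaryTree Unit} (hL : L ≠ .nil) (R : BinaryTree Unit) :
    initialUps (.node u L R) = initialUps L := by
  rw [initialUps, toList_toDyck_node, takeWhile_toDyck_append hL]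

theorem rightBranchLength_leftBranchAux (g acc : BinaryTree ℕ) (hg : g ≠ .nil) :
    rightBranchLength (shape (leftBranchAux g acc)) = initialUps (shape g) := by
  induction g generalizing acc with
  | nil => exact absurd rfl hg
  | node l L R ihL ihR =>
    by_cases h : L = .nil
    · subst h
      rw [leftBranchAux, leftBranchAux, shape_node, rightBranchLength]
      change _ = initialUps (.node () .nil (shape R))
      rw [initialUps_node_nil]
      by_cases hR : R = .nil
      · subst hR
        rfl
      · rw [ihR _ hR]
    · have hL : shape L ≠ .nil := by
        cases L with
        | nil => exact absurd rfl h
        | node => simp [shape_node]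
      rw [leftBranchAux, ihL _ h, shape_node, initialUps_node () hL]

theorem contactValue_riseContact (I : TamariInterval n) :
    contactValue (riseContact I) = initialRise I := by
  simp only [riseContact, Function.comp_apply]
  rw [contactValue_leftBranchInvolution, contactValue_eq]
  change leftBranchLength (mirror (shape (leftBranch (graftingTree I)))) = initialUps (upper I)
  rw [leftBranchLength_mirror, ← (exists_isGrafting I).2.2]
  by_cases h : graftingTree I = .nil
  · rw [h]
    rfl
  · exact rightBranchLength_leftBranchAux _ .nil h

end Tamari

theorem theorem54 (n : ℕ) :
    (∀ I J : Tamari.TamariInterval n, J = Tamari.leftBranchInvolution I ↔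
      Tamari.graftingTree J = Tamari.leftBranch (Tamari.graftingTree I)) ∧
    Function.Involutive (Tamari.riseContact (n := n)) ∧
    ∀ I : Tamari.TamariInterval n,
      Tamari.contactValue (Tamari.riseContact I) = Tamari.initialRise I ∧
      Tamari.initialRise (Tamari.riseContact I) = Tamari.contactValue I ∧
      (Tamari.contactVector (Tamari.riseContact I) : Multiset ℕ) =
        (Tamari.riseVector I : Multiset ℕ) ∧
      (Tamari.riseVector (Tamari.riseContact I) : Multiset ℕ) =
        (Tamari.contactVector I : Multiset ℕ) ∧
      Tamari.distance (Tamari.riseContact I) = Tamari.distance I ∧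
      Tamari.distance I = ((Tamari.tamariInversions I).ncard : WithBot ℕ∞) := by
  refine ⟨fun I J => ?_, Tamari.riseContact_involutive, fun I => ⟨?_, ?_, ?_, ?_, ?_, ?_⟩⟩
  · rw [← Tamari.graftingTree_leftBranchInvolution]
    exact Tamari.graftingTree_injective.eq_iff.symm
  · exact Tamari.contactValue_riseContact I
  -- The previous equality, applied to the image of `I` under β.
  · rw [← Tamari.contactValue_riseContact, Tamari.riseContact_involutive]
  · exact Tamari.contactVector_riseContact I
  · rw [← Tamari.contactVector_riseContact, Tamari.riseContact_involutive]
  · exact Tamari.distance_riseContact I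
  · exact Tamari.distance_eq_ncard I
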